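/- Let $D_1, D_2$ be integral domains, with quotient fields $K_1, K_2$. For an integral domain $D$ with quotient field $K$, a semistar operation on $D$ is a map $I\mapsto I^\star$ from the set of all $D$-submodules of $K$ to itself such that, for all $D$-submodules $I,J$ of $K$: $I\subseteq I^\star$; if $I\subseteq J$ then $I^\star\subseteq J^\star$; $(I^\star)^\star=I^\star$; and $xI^\star=(xI)^\star$ for every $x\in K$. It is stable if $(I\cap J)^\star=I^\star\cap J^\star$ for all nonzero $D$-submodules $I,J$ of $K$, and of finite type if $I^\star=\bigcup\{J^\star \mid J\subseteq I,\ J \text{ finitely generated over } D\}$ for every nonzero $D$-submodule $I$ of $K$. The set of all semistar operations on $D$ carries the Zariski topology, for which the sets $\{\star \mid 1\in F^\star\}$, with $F$ ranging over the nonzero $D$-submodules of $K$, form a subbasis of open sets; let $\widetilde{\mathrm{SStar}}(D)$ be the subspace of the stable semistar operations of finite type. Then $\mathrm{Spec}(D_1)$ and $\mathrm{Spec}(D_2)$ (with the Zariski topology) are homeomorphic if and only if $\widetilde{\mathrm{SStar}}(D_1)$ and $\widetilde{\mathrm{SStar}}(D_2)$ are homeomorphic. -/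

import Mathlib

open scoped Pointwise in
/-- A semistar operation on an integral domain `D` with quotient field `K`: a closure operation
`I ↦ I^⋆` on the set of all `D`-submodules of `K` such that `x I^⋆ = (x I)^⋆` for every `x ∈ K`.
(The case `x = 0` says that the zero submodule is fixed.) -/
@[ext]
structure SemistarOperation (D K : Type*) [CommRing D] [Field K] [Algebra D K] where
  /-- The underlying map `I ↦ I^⋆`. -/
  star : Submodule D K → Submodule D K
  le_star : ∀ I, I ≤ star I
  star_mono : ∀ I J, I ≤ J → star I ≤ star J
  star_star : ∀ I, star (star I) = star I
  smul_star : ∀ (x : K) (I : Submodule D K), x • star I = star (x • I)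

namespace SemistarOperation

variable {D K : Type*} [CommRing D] [Field K] [Algebra D K]

/-- `(I ∩ J)^⋆ = I^⋆ ∩ J^⋆` for all nonzero submodules `I`, `J` of `K`. -/
def IsStable (s : SemistarOperation D K) : Prop :=
  ∀ I J : Submodule D K, I ≠ ⊥ → J ≠ ⊥ → s.star (I ⊓ J) = s.star I ⊓ s.star J

/-- `I^⋆` is the union of the `J^⋆`, with `J ⊆ I` finitely generated over `D`, for all nonzero
submodules `I` of `K`. -/
def IsFiniteType (s : SemistarOperation D K) : Prop :=
  ∀ I : Submodule D K, I ≠ ⊥ →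
    (s.star I : Set K) = ⋃ J ∈ {J : Submodule D K | J ≤ I ∧ J.FG}, (s.star J : Set K)

/-- The Zariski topology on the set of semistar operations: the sets `{⋆ | 1 ∈ F^⋆}`, where `F`
ranges over the nonzero submodules of `K`, form a subbasis of open sets. -/
instance zariskiTopology : TopologicalSpace (SemistarOperation D K) :=
  TopologicalSpace.generateFrom
    {U | ∃ F : Submodule D K, F ≠ ⊥ ∧ U = {s : SemistarOperation D K | (1 : K) ∈ s.star F}}

end SemistarOperation

/-- The space of stable semistar operations of finite type, with the subspace topology of the
Zariski topology. -/
abbrev StableFiniteTypeSemistar (D K : Type*) [CommRing D] [Field K] [Algebra D K] : Type _ :=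
  {s : SemistarOperation D K // s.IsStable ∧ s.IsFiniteType}

/-! Write `D(J)` for the set of primes not containing `J`. A stable operation is determined by the
ideals `J` with `1 ∈ J^⋆`, because `x ∈ I^⋆` exactly when `(I : x)` is such an ideal
(`mem_star_iff_isDenseIdeal`). Under finite type, membership of `J` depends only on `D(J)`
(`IsDenseIdeal.of_idealOpen_le`), so the operation becomes a proper filter of open sets of the
spectrum generated by compact ones. Conversely every such filter defines an operation, idempotence
being the substantial point (`filterStar_filterStar`). Both topologies agree, so the space of
operations depends only on the spectrum as a space.

To go back, a spectral space `T` is recovered from its space of filters. Specialization there is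
reverse inclusion, so being irreducible for intersections of filters is a topological property of a
point. The irreducible filters are the neighbourhood filters of the points of `T`, by sobriety
(`exists_ofPoint_eq`). -/

section

open TopologicalSpace

/-- A proper filter of open sets of `T` generated by its quasi-compact members. When `T` is
spectral, such filters correspond to the nonempty quasi-compact saturated subsets of `T`. -/
@[ext]
structure CompactOpenFilter (T : Type*) [TopologicalSpace T] where
  /-- The open sets belonging to the filter. -/
  carrier : Set (Opens T)
  top_mem : ⊤ ∈ carrier
  bot_notMem : ⊥ ∉ carrier
  inf_mem : ∀ {U V}, U ∈ carrier → V ∈ carrier → U ⊓ V ∈ carrier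
  mem_of_le : ∀ {U V}, U ∈ carrier → U ≤ V → V ∈ carrier
  exists_isCompact : ∀ {U}, U ∈ carrier → ∃ V ∈ carrier, V ≤ U ∧ IsCompact (V : Set T)

/-- A point `x` is meet-irreducible if it is not the meet of two points different from it, where
`x` is considered smaller than `y` when `y` specializes to `x`. -/
def IsMeetIrreduciblePoint {X : Type*} [TopologicalSpace X] (x : X) : Prop :=
  ∀ y z : X, y ⤳ x → z ⤳ x → (∀ w, y ⤳ w → z ⤳ w → x ⤳ w) → x ⤳ y ∨ x ⤳ z

theorem Homeomorph.specializes_iff {X Y : Type*} [TopologicalSpace X] [TopologicalSpace Y]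
    (h : X ≃ₜ Y) {x y : X} : h x ⤳ h y ↔ x ⤳ y :=
  h.isInducing.specializes_iff

theorem Homeomorph.isMeetIrreduciblePoint_iff {X Y : Type*} [TopologicalSpace X]
    [TopologicalSpace Y] (h : X ≃ₜ Y) (x : X) :
    IsMeetIrreduciblePoint x ↔ IsMeetIrreduciblePoint (h x) := by
  simp only [IsMeetIrreduciblePoint, h.surjective.forall, h.specializes_iff]

/-! ### The space of filters of open sets -/

namespace CompactOpenFilter

variable {S T : Type*} [TopologicalSpace S] [TopologicalSpace T]

instance : Membership (Opens T) (CompactOpenFilter T) := ⟨fun F U => U ∈ F.carrier⟩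

theorem ext_mem {F G : CompactOpenFilter T} (h : ∀ U, U ∈ F ↔ U ∈ G) : F = G :=
  CompactOpenFilter.ext (Set.ext h)

instance : TopologicalSpace (CompactOpenFilter T) :=
  .generateFrom {A | ∃ U : Opens T, A = {F | U ∈ F}}

theorem isOpen_setOf_mem (U : Opens T) : IsOpen {F : CompactOpenFilter T | U ∈ F} :=
  isOpen_generateFrom_of_mem ⟨U, rfl⟩

theorem specializes_iff {F G : CompactOpenFilter T} : F ⤳ G ↔ ∀ U, U ∈ G → U ∈ F := by
  refine ⟨fun h U hU => specializes_iff_forall_open.1 h _ (isOpen_setOf_mem U) hU, fun h => ?_⟩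
  rw [Specializes, nhds_generateFrom, nhds_generateFrom]
  refine biInf_mono ?_
  rintro _ ⟨hs, U, rfl⟩
  exact ⟨h U hs, U, rfl⟩

/-- A homeomorphism transports filters of open sets. -/
def map (e : S ≃ₜ T) (F : CompactOpenFilter S) : CompactOpenFilter T where
  carrier := {U | Opens.comap (e : C(S, T)) U ∈ F}
  top_mem := F.top_mem
  bot_notMem := F.bot_notMem
  inf_mem hU hV := F.inf_mem hU hV
  mem_of_le hU h := F.mem_of_le hU fun _ hx => h hx
  exists_isCompact {U} hU := by
    obtain ⟨V, hV, hVU, hc⟩ := F.exists_isCompact hU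
    refine ⟨Opens.comap (e.symm : C(T, S)) V, ?_, fun x hx => ?_, ?_⟩
    · refine F.mem_of_le hV fun x hx => ?_
      change e.symm (e x) ∈ V
      rwa [e.symm_apply_apply]
    · have : e (e.symm x) ∈ U := hVU hx
      rwa [e.apply_symm_apply] at this
    · exact e.symm.isCompact_preimage.2 hc

theorem mem_map {e : S ≃ₜ T} {F : CompactOpenFilter S} {U : Opens T} :
    U ∈ F.map e ↔ Opens.comap (e : C(S, T)) U ∈ F := Iff.rfl

theorem continuous_map (e : S ≃ₜ T) : Continuous (map e) := by
  refine continuous_generateFrom_iff.2 ?_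
  rintro _ ⟨U, rfl⟩
  exact isOpen_setOf_mem _

theorem map_symm_map (e : S ≃ₜ T) (F : CompactOpenFilter S) : (F.map e).map e.symm = F := by
  refine ext_mem fun U => ?_
  rw [mem_map, mem_map]
  convert Iff.rfl
  ext x
  change _ ↔ e.symm (e x) ∈ U
  rw [e.symm_apply_apply]
  rfl

/-- Homeomorphic spaces have homeomorphic spaces of filters of open sets. -/
def congr (e : S ≃ₜ T) : CompactOpenFilter S ≃ₜ CompactOpenFilter T where
  toFun := map e
  invFun := map e.symm
  left_inv := map_symm_map e
  right_inv := map_symm_map e.symm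
  continuous_toFun := continuous_map e
  continuous_invFun := continuous_map e.symm

/-- The intersection of two filters. -/
def inter (F G : CompactOpenFilter T) : CompactOpenFilter T where
  carrier := F.carrier ∩ G.carrier
  top_mem := ⟨F.top_mem, G.top_mem⟩
  bot_notMem h := F.bot_notMem h.1
  inf_mem hU hV := ⟨F.inf_mem hU.1 hV.1, G.inf_mem hU.2 hV.2⟩
  mem_of_le hU h := ⟨F.mem_of_le hU.1 h, G.mem_of_le hU.2 h⟩
  exists_isCompact := by
    rintro U ⟨hF, hG⟩
    obtain ⟨V, hV, hVU, hVc⟩ := F.exists_isCompact hF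
    obtain ⟨W, hW, hWU, hWc⟩ := G.exists_isCompact hG
    exact ⟨V ⊔ W, ⟨F.mem_of_le hV le_sup_left, G.mem_of_le hW le_sup_right⟩,
      sup_le hVU hWU, hVc.union hWc⟩

/-- The filter generated by `F` and a quasi-compact open set `A` meeting all members of `F`. -/
def adjoin [QuasiSeparatedSpace T] (F : CompactOpenFilter T) (A : Opens T)
    (hA : IsCompact (A : Set T)) (h : ∀ U ∈ F, U ⊓ A ≠ ⊥) : CompactOpenFilter T where
  carrier := {U | ∃ V ∈ F, V ⊓ A ≤ U}
  top_mem := ⟨⊤, F.top_mem, le_top⟩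
  bot_notMem := fun ⟨V, hV, hVA⟩ => h V hV (le_bot_iff.1 hVA)
  inf_mem := by
    rintro U U' ⟨V, hV, hVU⟩ ⟨V', hV', hVU'⟩
    exact ⟨V ⊓ V', F.inf_mem hV hV', le_inf ((inf_le_inf_right _ inf_le_left).trans hVU)
      ((inf_le_inf_right _ inf_le_right).trans hVU')⟩
  mem_of_le := fun ⟨V, hV, hVU⟩ h => ⟨V, hV, hVU.trans h⟩
  exists_isCompact := by
    rintro U ⟨V, hV, hVU⟩
    obtain ⟨W, hW, hWV, hWc⟩ := F.exists_isCompact hV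
    exact ⟨W ⊓ A, ⟨W, hW, le_rfl⟩, (inf_le_inf_right _ hWV).trans hVU,
      hWc.inter_of_isOpen hA W.isOpen A.isOpen⟩

theorem mem_adjoin [QuasiSeparatedSpace T] (F : CompactOpenFilter T) {A : Opens T}
    (hA : IsCompact (A : Set T)) (h : ∀ U ∈ F, U ⊓ A ≠ ⊥) : A ∈ F.adjoin A hA h :=
  ⟨⊤, F.top_mem, inf_le_right⟩

/-- If `A` and `B` both meet every member of `F`, distributivity makes `F` the intersection of the
filters obtained by adjoining `A` and `B`, so it equals one of them. If some `U ∈ F` misses `A`,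
then `U ⊓ (A ⊔ B) ≤ B`, and symmetrically. -/
theorem mem_or_mem_of_isMeetIrreduciblePoint [QuasiSeparatedSpace T] {F : CompactOpenFilter T}
    (hF : IsMeetIrreduciblePoint F) {A B : Opens T} (hA : IsCompact (A : Set T))
    (hB : IsCompact (B : Set T)) (h : A ⊔ B ∈ F) : A ∈ F ∨ B ∈ F := by
  by_cases hA' : ∀ U ∈ F, U ⊓ A ≠ ⊥
  · by_cases hB' : ∀ U ∈ F, U ⊓ B ≠ ⊥
    · have key := hF (F.adjoin A hA hA') (F.adjoin B hB hB')
        (specializes_iff.2 fun U hU => ⟨U, hU, inf_le_left⟩)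
        (specializes_iff.2 fun U hU => ⟨U, hU, inf_le_left⟩) fun G hGA hGB =>
          specializes_iff.2 fun U hU => by
            obtain ⟨V, hV, hVU⟩ := specializes_iff.1 hGA U hU
            obtain ⟨W, hW, hWU⟩ := specializes_iff.1 hGB U hU
            refine F.mem_of_le (F.inf_mem (F.inf_mem hV hW) h) ?_
            rw [inf_sup_left]
            exact sup_le ((inf_le_inf_right _ inf_le_left).trans hVU)
              ((inf_le_inf_right _ inf_le_right).trans hWU)
      exact key.imp (fun k => specializes_iff.1 k A (mem_adjoin F hA hA'))
        (fun k => specializes_iff.1 k B (mem_adjoin F hB hB'))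
    · push Not at hB'
      obtain ⟨U, hU, hUB⟩ := hB'
      refine .inl (F.mem_of_le (F.inf_mem hU h) ?_)
      rw [inf_sup_left, hUB, sup_bot_eq]
      exact inf_le_right
  · push Not at hA'
    obtain ⟨U, hU, hUA⟩ := hA'
    refine .inr (F.mem_of_le (F.inf_mem hU h) ?_)
    rw [inf_sup_left, hUA, bot_sup_eq]
    exact inf_le_right

/-! ### Recovering a spectral space from its filters -/

section Spectral

variable [SpectralSpace T]

theorem exists_isCompact_mem_le {U : Opens T} {x : T} (hx : x ∈ U) :
    ∃ V : Opens T, IsCompact (V : Set T) ∧ x ∈ V ∧ V ≤ U :=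
  Opens.isBasis_iff_nbhd.1 (PrespectralSpace.isBasis_opens T) hx

/-- The filter of open neighbourhoods of a point. -/
def ofPoint (x : T) : CompactOpenFilter T where
  carrier := {U | x ∈ U}
  top_mem := trivial
  bot_notMem := id
  inf_mem hU hV := ⟨hU, hV⟩
  mem_of_le hU h := h hU
  exists_isCompact hU := by
    obtain ⟨V, hV, hx, hVU⟩ := exists_isCompact_mem_le hU
    exact ⟨V, hx, hVU, hV⟩

theorem mem_ofPoint {x : T} {U : Opens T} : U ∈ ofPoint x ↔ x ∈ U := Iff.rfl

/-- If `U ∈ F` and `V ∈ G` both avoid `x`, then `U ⊔ V` lies in `F.inter G` and still avoids `x`. -/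
theorem isMeetIrreduciblePoint_ofPoint (x : T) : IsMeetIrreduciblePoint (ofPoint x) := by
  intro F G _ _ hFG
  by_contra! h
  simp only [specializes_iff, not_forall] at h
  obtain ⟨⟨U, hU, hxU⟩, V, hV, hxV⟩ := h
  have key := specializes_iff.1 (hFG (F.inter G) (specializes_iff.2 fun _ h => h.1)
    (specializes_iff.2 fun _ h => h.2)) (U ⊔ V)
    ⟨F.mem_of_le hU le_sup_left, G.mem_of_le hV le_sup_right⟩
  exact (show x ∈ U ∨ x ∈ V from key).elim hxU hxV

/-- Primality of `F` on compact open sets makes `N` directed, so no compact member of `F` lies below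
`sSup N`, which is thus the largest open set outside `F`. Hence `F` consists of the open sets
meeting its complement. That closed set is irreducible, since `F` is stable under intersection, and
its generic point is `x`. -/
theorem exists_ofPoint_eq {F : CompactOpenFilter T} (hF : IsMeetIrreduciblePoint F) :
    ∃ x, ofPoint x = F := by
  set N : Set (Opens T) := {V | IsCompact (V : Set T) ∧ V ∉ F}
  have not_le {U : Opens T} (hU : U ∈ F) : ¬ U ≤ sSup N := fun hle => by
    obtain ⟨V, hV, hVU, hVc⟩ := F.exists_isCompact hU
    obtain ⟨W, hW, hVW⟩ := (CompleteLattice.isCompactElement_iff_le_of_directed_sSup_le _ V).1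
      ((Opens.isCompactElement_iff V).2 hVc) N ⟨⊥, isCompact_empty, F.bot_notMem⟩
      (fun A hA B hB => ⟨A ⊔ B, ⟨hA.1.union hB.1, fun h =>
        (mem_or_mem_of_isMeetIrreduciblePoint hF hA.1 hB.1 h).elim hA.2 hB.2⟩,
        le_sup_left, le_sup_right⟩) (hVU.trans hle)
    exact hW.2 (F.mem_of_le hV hVW)
  have le_of_notMem {U : Opens T} (hU : U ∉ F) : U ≤ sSup N := fun x hx => by
    obtain ⟨V, hV, hxV, hVU⟩ := exists_isCompact_mem_le hx
    exact Opens.mem_sSup.2 ⟨V, ⟨hV, fun h => hU (F.mem_of_le h hVU)⟩, hxV⟩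
  have meets {U : Opens T} : U ∈ F ↔ (((sSup N : Opens T) : Set T)ᶜ ∩ U).Nonempty := by
    constructor
    · intro hU
      obtain ⟨x, hxU, hx⟩ := Set.not_subset.1 (not_le hU)
      exact ⟨x, hx, hxU⟩
    · rintro ⟨x, hx, hxU⟩
      by_contra hU
      exact hx (le_of_notMem hU hxU)
  have hirr : IsIrreducible ((sSup N : Opens T) : Set T)ᶜ := by
    refine ⟨(meets.1 F.top_mem).mono Set.inter_subset_left, fun u v hu hv hu' hv' => ?_⟩
    exact meets.1 (F.inf_mem (meets.2 (show (_ ∩ ((⟨u, hu⟩ : Opens T) : Set T)).Nonempty from hu'))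
      (meets.2 (show (_ ∩ ((⟨v, hv⟩ : Opens T) : Set T)).Nonempty from hv')))
  obtain ⟨x, hx⟩ := QuasiSober.sober hirr (sSup N).isOpen.isClosed_compl
  refine ⟨x, ext_mem fun U => ?_⟩
  rw [mem_ofPoint, meets]
  exact hx.mem_open_set_iff U.isOpen

theorem ofPoint_injective : Function.Injective (ofPoint (T := T)) := fun x y h => by
  refine Inseparable.eq (inseparable_iff_forall_isOpen.2 fun U hU => ?_)
  have : (⟨U, hU⟩ : Opens T) ∈ ofPoint x ↔ (⟨U, hU⟩ : Opens T) ∈ ofPoint y := by rw [h]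
  exact this

variable (T) in
/-- The points of a spectral space correspond to the meet-irreducible points of its space of
filters of open sets. -/
noncomputable def equivMeetIrreducible :
    T ≃ {F : CompactOpenFilter T // IsMeetIrreduciblePoint F} :=
  Equiv.ofBijective (fun x => ⟨ofPoint x, isMeetIrreduciblePoint_ofPoint x⟩)
    ⟨fun _ _ h => ofPoint_injective (congrArg Subtype.val h), fun ⟨_, hF⟩ =>
      (exists_ofPoint_eq hF).imp fun _ h => Subtype.ext h⟩

variable (T) in
/-- A spectral space is recovered as the space of meet-irreducible points of its space of
filters of open sets. -/
noncomputable def homeomorphMeetIrreducible :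
    T ≃ₜ {F : CompactOpenFilter T // IsMeetIrreduciblePoint F} where
  toEquiv := equivMeetIrreducible T
  continuous_toFun := by
    refine Continuous.subtype_mk (continuous_generateFrom_iff.2 ?_) _
    rintro _ ⟨U, rfl⟩
    exact U.isOpen
  continuous_invFun := by
    refine continuous_def.2 fun U hU => ?_
    change IsOpen ((equivMeetIrreducible T).symm ⁻¹' U)
    rw [← Equiv.image_eq_preimage_symm]
    refine ⟨_, isOpen_setOf_mem ⟨U, hU⟩, ?_⟩
    ext ⟨F, hF⟩
    obtain ⟨x, rfl⟩ := exists_ofPoint_eq hF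
    refine ⟨fun h => ⟨x, h, rfl⟩, ?_⟩
    rintro ⟨y, hy, h⟩
    obtain rfl : y = x := ofPoint_injective (congrArg Subtype.val h)
    exact hy

end Spectral

/-- Spectral spaces with homeomorphic spaces of filters of open sets are homeomorphic. -/
theorem nonempty_homeomorph_iff [SpectralSpace S] [SpectralSpace T] :
    Nonempty (S ≃ₜ T) ↔ Nonempty (CompactOpenFilter S ≃ₜ CompactOpenFilter T) :=
  ⟨fun ⟨e⟩ => ⟨congr e⟩, fun ⟨e⟩ => ⟨(homeomorphMeetIrreducible S).trans
    ((e.subtype e.isMeetIrreduciblePoint_iff).trans (homeomorphMeetIrreducible T).symm)⟩⟩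

end CompactOpenFilter

open IsLocalization
open scoped Pointwise

/-! ### Ideals and open sets of the spectrum -/

namespace PrimeSpectrum

variable {D : Type*} [CommRing D]

/-- The open set of primes not containing the ideal `J`. -/
def idealOpen (J : Ideal D) : Opens (PrimeSpectrum D) :=
  ⟨(zeroLocus (J : Set D))ᶜ, (isClosed_zeroLocus _).isOpen_compl⟩

theorem mem_idealOpen {J : Ideal D} {p : PrimeSpectrum D} :
    p ∈ idealOpen J ↔ ∃ j ∈ J, j ∉ p.asIdeal :=
  Set.not_subset

theorem idealOpen_le_idealOpen {I J : Ideal D} : idealOpen I ≤ idealOpen J ↔ I ≤ J.radical :=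
  Set.compl_subset_compl.trans (zeroLocus_subset_zeroLocus_iff J I)

theorem idealOpen_mono {I J : Ideal D} (h : I ≤ J) : idealOpen I ≤ idealOpen J :=
  idealOpen_le_idealOpen.2 (h.trans Ideal.le_radical)

theorem idealOpen_top : idealOpen (⊤ : Ideal D) = ⊤ :=
  top_le_iff.1 fun p _ => mem_idealOpen.2 ⟨1, trivial, p.2.one_notMem⟩

theorem idealOpen_bot : idealOpen (⊥ : Ideal D) = ⊥ :=
  le_bot_iff.1 fun p hp => by
    obtain ⟨_, rfl, h⟩ := mem_idealOpen.1 hp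
    exact h p.asIdeal.zero_mem

theorem idealOpen_inf (I J : Ideal D) : idealOpen (I ⊓ J) = idealOpen I ⊓ idealOpen J :=
  Opens.ext <| by
    change (zeroLocus _)ᶜ = (zeroLocus _)ᶜ ∩ (zeroLocus _)ᶜ
    rw [zeroLocus_inf, Set.compl_union]

theorem idealOpen_sup_le (I J : Ideal D) : idealOpen (I ⊔ J) ≤ idealOpen I ⊔ idealOpen J := by
  intro p hp
  by_contra h
  have h' : ¬ (p ∈ idealOpen I ∨ p ∈ idealOpen J) := h
  rw [not_or] at h'
  exact hp (sup_le (not_not.1 h'.1) (not_not.1 h'.2) : I ⊔ J ≤ p.asIdeal)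

theorem exists_idealOpen_eq (U : Opens (PrimeSpectrum D)) : ∃ J : Ideal D, idealOpen J = U := by
  obtain ⟨J, hJ⟩ := (isClosed_iff_zeroLocus_ideal _).1 U.isOpen.isClosed_compl
  exact ⟨J, Opens.ext (by change (zeroLocus _)ᶜ = _; rw [← hJ, compl_compl])⟩

theorem isCompact_idealOpen {J : Ideal D} (hJ : J.FG) :
    IsCompact (idealOpen J : Set (PrimeSpectrum D)) :=
  (isCompact_isOpen_iff_ideal.2 ⟨J, hJ, rfl⟩).1

/-- `idealOpen J` is the directed union of the `idealOpen I` with `I ≤ J` finitely generated. -/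
theorem exists_fg_le_of_isCompact {U : Opens (PrimeSpectrum D)} {J : Ideal D}
    (hU : IsCompact (U : Set (PrimeSpectrum D))) (h : U ≤ idealOpen J) :
    ∃ I : Ideal D, I.FG ∧ I ≤ J ∧ U ≤ idealOpen I := by
  obtain ⟨_, ⟨I, hI, hIJ, rfl⟩, hUI⟩ :=
    (CompleteLattice.isCompactElement_iff_le_of_directed_sSup_le _ U).1
      ((Opens.isCompactElement_iff U).2 hU) {V | ∃ I : Ideal D, I.FG ∧ I ≤ J ∧ idealOpen I = V}
      ⟨_, ⊥, Submodule.fg_bot, bot_le, rfl⟩ (by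
        rintro _ ⟨A, hA, hAJ, rfl⟩ _ ⟨B, hB, hBJ, rfl⟩
        exact ⟨_, ⟨A ⊔ B, Submodule.FG.sup hA hB, sup_le hAJ hBJ, rfl⟩, idealOpen_mono le_sup_left,
          idealOpen_mono le_sup_right⟩) (fun p hp => by
        obtain ⟨j, hj, hjp⟩ := mem_idealOpen.1 (h hp)
        refine Opens.mem_sSup.2 ⟨_, ⟨Ideal.span {j}, ⟨{j}, by simp⟩, ?_, rfl⟩, ?_⟩
        · rwa [Ideal.span_singleton_le_iff_mem]
        · exact mem_idealOpen.2 ⟨j, Ideal.mem_span_singleton_self j, hjp⟩)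
  exact ⟨I, hI, hIJ, hUI⟩

end PrimeSpectrum

open PrimeSpectrum

/-! ### Conductor ideals -/

section Conductor

variable {D K : Type*} [CommRing D] [Field K] [Algebra D K]

/-- The ideal `(I : x)` of all `d` with `d x ∈ I`. -/
def Submodule.conductor (I : Submodule D K) (x : K) : Ideal D :=
  I.comap (LinearMap.toSpanSingleton D K x)

namespace Submodule

theorem mem_conductor {I : Submodule D K} {x : K} {d : D} : d ∈ I.conductor x ↔ d • x ∈ I :=
  Iff.rfl

theorem conductor_inf (I J : Submodule D K) (x : K) :
    (I ⊓ J).conductor x = I.conductor x ⊓ J.conductor x := rfl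

theorem conductor_mono {I J : Submodule D K} (h : I ≤ J) (x : K) :
    I.conductor x ≤ J.conductor x := fun _ hd => h hd

theorem conductor_eq_top {I : Submodule D K} {x : K} (h : x ∈ I) : I.conductor x = ⊤ :=
  top_le_iff.1 fun d _ => I.smul_mem d h

theorem conductor_coeSubmodule_one [IsDomain D] [IsFractionRing D K] (J : Ideal D) :
    (coeSubmodule K J).conductor 1 = J := by
  ext d
  rw [mem_conductor, mem_coeSubmodule, Algebra.smul_def, mul_one]
  exact ⟨fun ⟨y, hy, h⟩ => IsFractionRing.injective D K h ▸ hy, fun h => ⟨d, h, rfl⟩⟩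

theorem coeSubmodule_conductor_one (I : Submodule D K) :
    coeSubmodule K (I.conductor 1) = I ⊓ coeSubmodule K ⊤ := by
  ext x
  simp only [mem_coeSubmodule, mem_conductor, Submodule.mem_inf, Algebra.smul_def, mul_one,
    Submodule.mem_top, true_and]
  constructor
  · rintro ⟨y, hy, rfl⟩
    exact ⟨hy, y, rfl⟩
  · rintro ⟨hx, y, rfl⟩
    exact ⟨y, hx, rfl⟩

theorem conductor_smul {x : K} (hx : x ≠ 0) (I : Submodule D K) (y : K) :
    (x • I).conductor y = I.conductor (x⁻¹ * y) := by
  ext d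
  rw [mem_conductor, mem_conductor, mem_smul_iff_inv_mul_mem hx, mul_smul_comm]

theorem zero_smul' (I : Submodule D K) : (0 : K) • I = ⊥ := by
  ext y
  rw [Submodule.mem_smul_pointwise_iff_exists, Submodule.mem_bot]
  constructor
  · rintro ⟨b, _, rfl⟩
    exact zero_smul K b
  · rintro rfl
    exact ⟨0, I.zero_mem, zero_smul K 0⟩

end Submodule

end Conductor

namespace SemistarOperation

variable {D K : Type*} [CommRing D] [Field K] [Algebra D K]

/-! ### From operations to filters -/

section Filter

/-- The ideals `J` with `1 ∈ J^⋆`. -/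
def IsDenseIdeal (s : SemistarOperation D K) (J : Ideal D) : Prop :=
  (1 : K) ∈ s.star (coeSubmodule K J)

variable {s : SemistarOperation D K}

theorem star_bot (s : SemistarOperation D K) : s.star ⊥ = ⊥ := by
  have h := s.smul_star 0 ⊥
  rwa [Submodule.zero_smul', Submodule.zero_smul', eq_comm] at h

theorem star_le_of_le {I J : Submodule D K} (h : I ≤ s.star J) : s.star I ≤ s.star J :=
  s.star_star J ▸ s.star_mono _ _ h

theorem IsDenseIdeal.mono {I J : Ideal D} (hI : s.IsDenseIdeal I) (h : I ≤ J) :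
    s.IsDenseIdeal J :=
  s.star_mono _ _ (coeSubmodule_mono K h) hI

theorem isDenseIdeal_top : s.IsDenseIdeal ⊤ :=
  s.le_star _ ((mem_coeSubmodule K _).2 ⟨1, trivial, map_one _⟩)

theorem not_isDenseIdeal_bot : ¬ s.IsDenseIdeal ⊥ := by
  rw [IsDenseIdeal, coeSubmodule_bot, star_bot]
  exact one_ne_zero

/-- For `x ∈ I`, `x = x • 1` lies in `x J^⋆ = (x J)^⋆ ⊆ (I J)^⋆`; hence `I^⋆ ⊆ (I J)^⋆`. -/
theorem IsDenseIdeal.mul {I J : Ideal D} (hI : s.IsDenseIdeal I) (hJ : s.IsDenseIdeal J) :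
    s.IsDenseIdeal (I * J) := by
  refine star_le_of_le (fun x hx => ?_) hI
  have h : x • (1 : K) ∈ x • s.star (coeSubmodule K J) := Submodule.smul_mem_pointwise_smul _ _ _ hJ
  rw [smul_eq_mul, mul_one, s.smul_star] at h
  refine s.star_mono _ _ ?_ h
  intro y hy
  obtain ⟨b, hb, rfl⟩ := (Submodule.mem_smul_pointwise_iff_exists _ _ _).1 hy
  rw [coeSubmodule_mul]
  exact Submodule.mul_mem_mul hx hb

theorem IsDenseIdeal.pow {I : Ideal D} (hI : s.IsDenseIdeal I) (n : ℕ) :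
    s.IsDenseIdeal (I ^ n) := by
  induction n with
  | zero => rw [pow_zero, Ideal.one_eq_top]; exact isDenseIdeal_top
  | succ n ih => rw [pow_succ]; exact ih.mul hI

theorem IsDenseIdeal.exists_fg [IsDomain D] [IsFractionRing D K] (hs : s.IsFiniteType)
    {J : Ideal D} (hJ : s.IsDenseIdeal J) : ∃ I : Ideal D, I.FG ∧ I ≤ J ∧ s.IsDenseIdeal I := by
  have hJ0 : coeSubmodule K J ≠ ⊥ := fun h => by
    rw [IsDenseIdeal, h, star_bot] at hJ
    exact one_ne_zero hJ
  have h : (1 : K) ∈ (s.star (coeSubmodule K J) : Set K) := hJ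
  rw [hs _ hJ0] at h
  simp only [Set.mem_iUnion] at h
  obtain ⟨A, ⟨hAJ, hA⟩, h1⟩ := h
  -- `A` lies in the image of `D`, so it comes from an ideal.
  have hAe : coeSubmodule K (A.conductor 1) = A := by
    rw [Submodule.coeSubmodule_conductor_one, inf_eq_left]
    exact hAJ.trans (coeSubmodule_mono K le_top)
  refine ⟨A.conductor 1, ?_, ?_, ?_⟩
  · exact (coeSubmodule_fg K (IsFractionRing.injective D K) _).1 (hAe.symm ▸ hA)
  · rw [← IsFractionRing.coeSubmodule_le_coeSubmodule (K := K), hAe]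
    exact hAJ
  · rwa [IsDenseIdeal, hAe]

/-- Finite type gives a finitely generated dense `A ≤ I`. As `A` lies in the radical of `J`, some
power of `A` lies in `J`, and powers of dense ideals are dense. -/
theorem IsDenseIdeal.of_idealOpen_le [IsDomain D] [IsFractionRing D K] (hs : s.IsFiniteType)
    {I J : Ideal D} (hI : s.IsDenseIdeal I) (h : idealOpen I ≤ idealOpen J) :
    s.IsDenseIdeal J := by
  obtain ⟨A, hA, hAI, hAd⟩ := hI.exists_fg hs
  obtain ⟨n, hn⟩ := Ideal.exists_pow_le_of_le_radical_of_fg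
    (hAI.trans (idealOpen_le_idealOpen.1 h)) hA
  exact (hAd.pow n).mono hn

/-- Homogeneity reduces to `x = 1`; there stability allows replacing the submodule by its
intersection with `D`. -/
theorem mem_star_iff_isDenseIdeal [IsDomain D] [IsFractionRing D K] (hs : s.IsStable)
    {I : Submodule D K} {x : K} : x ∈ s.star I ↔ s.IsDenseIdeal (I.conductor x) := by
  have one_mem (A : Submodule D K) : (1 : K) ∈ s.star A ↔ s.IsDenseIdeal (A.conductor 1) := by
    rw [IsDenseIdeal, Submodule.coeSubmodule_conductor_one]
    by_cases hA : A = ⊥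
    · rw [hA, bot_inf_eq]
    · rw [hs _ _ hA, Submodule.mem_inf]
      · exact ⟨fun h => ⟨h, isDenseIdeal_top⟩, fun h => h.1⟩
      · intro h
        have h1 : (1 : K) ∈ coeSubmodule K (⊤ : Ideal D) :=
          (mem_coeSubmodule K _).2 ⟨1, trivial, map_one _⟩
        rw [h] at h1
        exact one_ne_zero h1
  by_cases hx : x = 0
  · subst hx
    rw [Submodule.conductor_eq_top I.zero_mem]
    exact ⟨fun _ => isDenseIdeal_top, fun _ => Submodule.zero_mem _⟩
  · have hx' := inv_ne_zero hx
    have h1 : x ∈ s.star I ↔ (1 : K) ∈ s.star (x⁻¹ • I) := by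
      rw [← s.smul_star, Submodule.mem_smul_iff_inv_mul_mem hx', inv_inv, mul_one]
    rw [h1, one_mem, Submodule.conductor_smul hx', inv_inv, mul_one]

/-- The filter of open sets of the spectrum defined by the ideals `J` with `1 ∈ J^⋆`. -/
def toFilter [IsDomain D] [IsFractionRing D K] (s : SemistarOperation D K)
    (hs : s.IsFiniteType) : CompactOpenFilter (PrimeSpectrum D) where
  carrier := {U | ∃ J : Ideal D, idealOpen J = U ∧ s.IsDenseIdeal J}
  top_mem := ⟨⊤, idealOpen_top, isDenseIdeal_top⟩
  bot_notMem := by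
    rintro ⟨J, hJ, hd⟩
    exact not_isDenseIdeal_bot (hd.of_idealOpen_le hs (hJ.trans idealOpen_bot.symm).le)
  inf_mem := by
    rintro _ _ ⟨I, rfl, hI⟩ ⟨J, rfl, hJ⟩
    exact ⟨I ⊓ J, idealOpen_inf I J, (hI.mul hJ).mono Ideal.mul_le_inf⟩
  mem_of_le := by
    rintro _ V ⟨I, rfl, hI⟩ h
    obtain ⟨J, rfl⟩ := exists_idealOpen_eq V
    exact ⟨J, rfl, hI.of_idealOpen_le hs h⟩
  exists_isCompact := by
    rintro _ ⟨I, rfl, hI⟩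
    obtain ⟨A, hA, hAI, hAd⟩ := hI.exists_fg hs
    exact ⟨_, ⟨A, rfl, hAd⟩, idealOpen_mono hAI, isCompact_idealOpen hA⟩

theorem idealOpen_mem_toFilter [IsDomain D] [IsFractionRing D K] (hs : s.IsFiniteType)
    {J : Ideal D} : idealOpen J ∈ s.toFilter hs ↔ s.IsDenseIdeal J :=
  ⟨fun ⟨_, h, hI⟩ => hI.of_idealOpen_le hs h.le, fun h => ⟨J, rfl, h⟩⟩

end Filter

/-! ### From filters to operations -/

section OfFilter

variable (F : CompactOpenFilter (PrimeSpectrum D))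

/-- A prime that omits some `b ∈ B` and also omits `j` omits `b * j ∈ A`. This settles one
generator; finite generation of `J` keeps the intersection of the sets `W` finite. -/
theorem exists_inf_idealOpen_le {A J : Ideal D} (hJ : J.FG)
    (h : ∀ j ∈ J, ∃ B : Ideal D, idealOpen B ∈ F ∧ ∀ b ∈ B, b * j ∈ A) :
    ∃ W ∈ F, W ⊓ idealOpen J ≤ idealOpen A := by
  induction J, hJ using Submodule.fg_induction with
  | singleton j =>
    obtain ⟨B, hB, hBA⟩ := h j (Ideal.mem_span_singleton_self j)
    refine ⟨_, hB, fun p hp => ?_⟩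
    obtain ⟨b, hb, hbp⟩ := mem_idealOpen.1 hp.1
    obtain ⟨c, hc, hcp⟩ := mem_idealOpen.1 hp.2
    obtain ⟨d, rfl⟩ := Ideal.mem_span_singleton'.1 hc
    exact mem_idealOpen.2 ⟨b * j, hBA b hb, fun hm => (p.2.mem_or_mem hm).elim hbp fun hj =>
      hcp (p.asIdeal.mul_mem_left d hj)⟩
  | sup J₁ J₂ _ _ ih₁ ih₂ =>
    obtain ⟨V, hV, hVA⟩ := ih₁ fun j hj => h j (Submodule.mem_sup_left hj)
    obtain ⟨W, hW, hWA⟩ := ih₂ fun j hj => h j (Submodule.mem_sup_right hj)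
    refine ⟨V ⊓ W, F.inf_mem hV hW, (inf_le_inf_left _ (idealOpen_sup_le _ _)).trans ?_⟩
    rw [inf_sup_left]
    exact sup_le ((inf_le_inf_right _ inf_le_left).trans hVA)
      ((inf_le_inf_right _ inf_le_right).trans hWA)

/-- The submodule of all `x` such that the open set of `(I : x)` belongs to the filter `F`. -/
def filterStar (I : Submodule D K) : Submodule D K where
  carrier := {x | idealOpen (I.conductor x) ∈ F}
  zero_mem' := by
    rw [Set.mem_ofPred_eq, Submodule.conductor_eq_top I.zero_mem, idealOpen_top]
    exact F.top_mem
  add_mem' {x y} hx hy := by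
    refine F.mem_of_le (F.inf_mem hx hy) ?_
    rw [← idealOpen_inf]
    refine idealOpen_mono fun d hd => ?_
    rw [Submodule.mem_conductor, smul_add]
    exact I.add_mem hd.1 hd.2
  smul_mem' c x hx := F.mem_of_le hx <| idealOpen_mono fun d hd => by
    rw [Submodule.mem_conductor, smul_comm]
    exact I.smul_mem c hd

variable {F}

theorem mem_filterStar {I : Submodule D K} {x : K} :
    x ∈ filterStar F I ↔ idealOpen (I.conductor x) ∈ F := Iff.rfl

/-- Here properness of `F` is used; it gives homogeneity at the scalar `0`. -/
theorem filterStar_bot [IsDomain D] [IsFractionRing D K] :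
    filterStar F (⊥ : Submodule D K) = ⊥ := by
  refine (Submodule.eq_bot_iff _).2 fun x hx => ?_
  by_contra hx0
  have h : (⊥ : Submodule D K).conductor x = ⊥ := by
    refine (Submodule.eq_bot_iff _).2 fun d hd => ?_
    rw [Submodule.mem_conductor, Submodule.mem_bot, Algebra.smul_def, mul_eq_zero] at hd
    exact (IsFractionRing.to_map_eq_zero_iff (K := K)).1 (hd.resolve_right hx0)
  rw [mem_filterStar, h, idealOpen_bot] at hx
  exact F.bot_notMem hx

theorem le_filterStar (I : Submodule D K) : I ≤ filterStar F I := fun x hx => by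
  rw [mem_filterStar, Submodule.conductor_eq_top hx, idealOpen_top]
  exact F.top_mem

theorem filterStar_mono {I J : Submodule D K} (h : I ≤ J) : filterStar F I ≤ filterStar F J :=
  fun x hx => F.mem_of_le hx (idealOpen_mono (Submodule.conductor_mono h x))

theorem filterStar_filterStar (I : Submodule D K) :
    filterStar F (filterStar F I) = filterStar F I := by
  refine le_antisymm (fun x hx => ?_) (le_filterStar _)
  -- Compactness replaces the conductor of `x` into `filterStar F I` by a finitely generated ideal
  -- `J`, so that only finitely many members of `F` need to be intersected.
  obtain ⟨V, hV, hVI, hVc⟩ := F.exists_isCompact hx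
  obtain ⟨J, hJ, hJI, hVJ⟩ := exists_fg_le_of_isCompact hVc hVI
  obtain ⟨W, hW, hWI⟩ := exists_inf_idealOpen_le F (A := I.conductor x) hJ fun j hj =>
    ⟨I.conductor (j • x), hJI hj, fun b hb => by
      rwa [Submodule.mem_conductor, mul_smul]⟩
  exact F.mem_of_le (F.inf_mem hW hV) ((inf_le_inf_left _ hVJ).trans hWI)

theorem smul_filterStar [IsDomain D] [IsFractionRing D K] (x : K) (I : Submodule D K) :
    x • filterStar F I = filterStar F (x • I) := by
  by_cases hx : x = 0
  · rw [hx, Submodule.zero_smul', Submodule.zero_smul', filterStar_bot]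
  · ext y
    rw [Submodule.mem_smul_iff_inv_mul_mem hx, mem_filterStar, mem_filterStar,
      Submodule.conductor_smul hx]

variable (K F) in
/-- The semistar operation defined by a filter of open sets of the spectrum. -/
def ofFilter [IsDomain D] [IsFractionRing D K] : SemistarOperation D K where
  star := filterStar F
  le_star := le_filterStar
  star_mono _ _ := filterStar_mono
  star_star := filterStar_filterStar
  smul_star := smul_filterStar

variable [IsDomain D] [IsFractionRing D K]

theorem mem_star_ofFilter {I : Submodule D K} {x : K} :
    x ∈ (ofFilter K F).star I ↔ idealOpen (I.conductor x) ∈ F := Iff.rfl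

theorem isStable_ofFilter : (ofFilter K F).IsStable := fun I J _ _ => by
  ext x
  rw [Submodule.mem_inf, mem_star_ofFilter, mem_star_ofFilter, mem_star_ofFilter,
    Submodule.conductor_inf, idealOpen_inf]
  exact ⟨fun h => ⟨F.mem_of_le h inf_le_left, F.mem_of_le h inf_le_right⟩,
    fun h => F.inf_mem h.1 h.2⟩

theorem isFiniteType_ofFilter : (ofFilter K F).IsFiniteType := fun I _ => by
  refine Set.Subset.antisymm (fun x hx => ?_) (Set.iUnion₂_subset fun J hJ =>
    (ofFilter K F).star_mono _ _ hJ.1)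
  obtain ⟨V, hV, hVI, hVc⟩ := F.exists_isCompact (mem_star_ofFilter.1 hx)
  obtain ⟨A, hA, hAI, hVA⟩ := exists_fg_le_of_isCompact hVc hVI
  -- The witness is `A x`, whose conductor at `x` contains `A`.
  refine Set.mem_iUnion₂.2 ⟨Submodule.map (LinearMap.toSpanSingleton D K x) A,
    ⟨Submodule.map_le_iff_le_comap.2 hAI, Submodule.FG.map _ hA⟩, ?_⟩
  exact F.mem_of_le hV (hVA.trans (idealOpen_mono (Submodule.le_comap_map _ _)))

theorem isDenseIdeal_ofFilter {J : Ideal D} :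
    (ofFilter K F).IsDenseIdeal J ↔ idealOpen J ∈ F := by
  rw [IsDenseIdeal, mem_star_ofFilter, Submodule.conductor_coeSubmodule_one]

end OfFilter

variable (D K) in
/-- Stable semistar operations of finite type correspond to filters of open sets of the spectrum
generated by quasi-compact open sets. -/
def homeomorphCompactOpenFilter [IsDomain D] [IsFractionRing D K] :
    StableFiniteTypeSemistar D K ≃ₜ CompactOpenFilter (PrimeSpectrum D) where
  toFun s := s.1.toFilter s.2.2
  invFun F := ⟨ofFilter K F, isStable_ofFilter, isFiniteType_ofFilter⟩
  left_inv s := by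
    refine Subtype.ext (SemistarOperation.ext (funext fun I => Submodule.ext fun x => ?_))
    rw [mem_star_ofFilter, idealOpen_mem_toFilter, mem_star_iff_isDenseIdeal s.2.1]
  right_inv F := by
    refine CompactOpenFilter.ext_mem fun U => ?_
    obtain ⟨J, rfl⟩ := exists_idealOpen_eq U
    rw [idealOpen_mem_toFilter, isDenseIdeal_ofFilter]
  continuous_toFun := by
    refine continuous_generateFrom_iff.2 ?_
    rintro _ ⟨U, rfl⟩
    obtain ⟨J, rfl⟩ := exists_idealOpen_eq U
    change IsOpen {s : StableFiniteTypeSemistar D K | idealOpen J ∈ s.1.toFilter s.2.2}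
    simp only [idealOpen_mem_toFilter]
    -- The subbasis only uses nonzero submodules; for the zero ideal the set is empty.
    by_cases hJ : coeSubmodule K J = ⊥
    · convert isOpen_empty
      refine Set.eq_empty_of_forall_notMem fun s hs => ?_
      rw [Set.mem_ofPred_eq, IsDenseIdeal, hJ, star_bot] at hs
      exact one_ne_zero hs
    · exact continuous_subtype_val.isOpen_preimage _
        (show IsOpen {s : SemistarOperation D K | (1 : K) ∈ s.star (coeSubmodule K J)} from
          TopologicalSpace.isOpen_generateFrom_of_mem ⟨_, hJ, rfl⟩)
  continuous_invFun := by
    refine Continuous.subtype_mk (continuous_generateFrom_iff.2 ?_) _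
    rintro _ ⟨I, _, rfl⟩
    exact CompactOpenFilter.isOpen_setOf_mem (idealOpen (I.conductor 1))

end SemistarOperation

end

theorem corollary5p5 {D₁ D₂ K₁ K₂ : Type*}
    [CommRing D₁] [IsDomain D₁] [Field K₁] [Algebra D₁ K₁] [IsFractionRing D₁ K₁]
    [CommRing D₂] [IsDomain D₂] [Field K₂] [Algebra D₂ K₂] [IsFractionRing D₂ K₂] :
    Nonempty (PrimeSpectrum D₁ ≃ₜ PrimeSpectrum D₂) ↔
      Nonempty (StableFiniteTypeSemistar D₁ K₁ ≃ₜ StableFiniteTypeSemistar D₂ K₂) := 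
  CompactOpenFilter.nonempty_homeomorph_iff.trans
    ⟨fun ⟨e⟩ => ⟨(SemistarOperation.homeomorphCompactOpenFilter D₁ K₁).trans
      (e.trans (SemistarOperation.homeomorphCompactOpenFilter D₂ K₂).symm)⟩,
    fun ⟨e⟩ => ⟨(SemistarOperation.homeomorphCompactOpenFilter D₁ K₁).symm.trans
      (e.trans (SemistarOperation.homeomorphCompactOpenFilter D₂ K₂))⟩⟩
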